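/- Let $G=(\Sigma,Q,\delta,\tilde\pi)$ be a probabilistic finite-state automaton: $\Sigma$ is a finite alphabet, $Q$ is a finite non-empty set of states, $\tilde\pi(q,\cdot)$ is a probability distribution on $\Sigma$ for every $q\in Q$, and $\delta$ is a partial map from $Q\times\Sigma$ to $Q$ such that $\delta(q,\sigma)$ is undefined exactly when $\tilde\pi(q,\sigma)=0$. In the state $q$ the automaton outputs the symbol $\sigma$ with probability $\tilde\pi(q,\sigma)$ and moves to the state $\delta(q,\sigma)$. Assume that the graph of $G$ (vertex set $Q$, an edge from $q$ to $\delta(q,\sigma)$ whenever the latter is defined) is strongly connected, and let $\Pi$ be the transition matrix $\pi(q,q')=\sum_{\sigma:\,\delta(q,\sigma)=q'}\tilde\pi(q,\sigma)$. Then there is exactly one probability distribution $\mathbf p_G$ on $Q$ with $\mathbf p_G\Pi=\mathbf p_G$, and every $\Sigma$-valued process $X_1,X_2,\dots$ that has the law of the output of $G$ with initial state distribution $\mathbf p_G$ is 1. stationary: for all times $t_1,\dots,t_k\ge 1$ and all $h\ge 0$, $(X_{t_1+h},\dots,X_{t_k+h})$ and $(X_{t_1},\dots,X_{t_k})$ have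 the same distribution; 2. ergodic: for all times $t_1,\dots,t_k\ge1$ and all symbols $w_1,\dots,w_k\in\Sigma$, almost surely $$\lim_{N\to\infty}\frac1N\,\#\{\,0\le s<N : X_{t_j+s}=w_j \text{ for } j=1,\dots,k\,\}=\Pr(X_{t_1}=w_1,\dots,X_{t_k}=w_k);$$ moreover, the left shift on $\Sigma^{\mathbb N^+}$ is an ergodic measure-preserving map for the law of the process. -/

import Mathlib

open MeasureTheory ProbabilityTheory Filter Topology

/-- A probabilistic finite-state automaton over the alphabet `A` with state set `Q` (both are
assumed finite where it matters): a partial transition map `δ` and, for each state, a probability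
distribution on the alphabet. The transition `δ q a` is undefined (`none`) exactly when the
symbol `a` has probability zero in the state `q`. -/
structure PFSA (A Q : Type*) where
  /-- the partial transition map -/
  δ : Q → A → Option Q
  /-- the observation probabilities -/
  obs : Q → PMF A
  δ_eq_none_iff : ∀ q a, δ q a = none ↔ obs q a = 0

namespace PFSA

variable {A Q : Type*}

/-- The state reached from `q` by reading a word along the edges of the graph of `G`, if any. -/
def run (G : PFSA A Q) (q : Q) (w : List A) : Option Q :=
  w.foldlM G.δ q

/-- The graph of `G` is strongly connected. -/
def StronglyConnected (G : PFSA A Q) : Prop :=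
  ∀ q q' : Q, ∃ w : List A, G.run q w = some q'

open Classical in
/-- The transition matrix: the entry at `(q, q')` is the sum of the probabilities of the symbols
that lead from `q` to `q'`. -/
noncomputable def transitionMatrix [Fintype A] (G : PFSA A Q) : Matrix Q Q ℝ :=
  Matrix.of fun q q' => ∑ a with G.δ q a = some q', (G.obs q a).toReal

/-- `p` is a stationary distribution of the transition matrix of `G`: `p Π = p`. -/
def IsStationaryDistribution [Fintype A] [Fintype Q] (G : PFSA A Q) (p : PMF Q) : Prop :=
  Matrix.vecMul (fun q => (p q).toReal) G.transitionMatrix = fun q => (p q).toReal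

/-- The state after outputting `a` in the state `q`. The default value `q` is used only when
`a` has probability zero in the state `q`. -/
def next (G : PFSA A Q) (q : Q) (a : A) : Q :=
  (G.δ q a).getD q

/-- The joint law of (current state, output symbol) when the current state has law `p`. -/
noncomputable def emit (G : PFSA A Q) (p : PMF Q) : PMF (Q × A) :=
  p.bind fun q => (G.obs q).map fun a => (q, a)

section Law

variable [MeasurableSpace A] [MeasurableSpace Q]
  [Countable A] [Countable Q] [MeasurableSingletonClass A] [MeasurableSingletonClass Q]

/-- One step of the automaton: from (state, symbol) `(q, a)`, move to the state `next q a` and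
output a symbol there. -/
noncomputable def stepKernel (G : PFSA A Q) : Kernel (Q × A) (Q × A) :=
  Kernel.ofFunOfCountable fun z => (G.emit (PMF.pure (G.next z.1 z.2))).toMeasure

instance (G : PFSA A Q) : IsMarkovKernel G.stepKernel :=
  ⟨fun z => inferInstanceAs
    (IsProbabilityMeasure (G.emit (PMF.pure (G.next z.1 z.2))).toMeasure)⟩

/-- `stepKernel` as a kernel that reads the history up to time `n` and uses only its last
entry. -/
noncomputable def historyKernel (G : PFSA A Q) (n : ℕ) :
    Kernel (Finset.Iic n → Q × A) (Q × A) :=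
  G.stepKernel.comap (fun h => h ⟨n, Finset.mem_Iic.2 le_rfl⟩) (measurable_pi_apply _)

instance (G : PFSA A Q) (n : ℕ) : IsMarkovKernel (G.historyKernel n) := by
  unfold historyKernel; infer_instance

/-- The law of the sequence of (state, symbol) pairs produced by `G` when the initial state has
law `p`. The entry `n` is the state just before the `(n + 1)`-st output and that output. -/
noncomputable def pathLaw (G : PFSA A Q) (p : PMF Q) : Measure (ℕ → Q × A) :=
  Kernel.trajMeasure (X := fun _ => Q × A) (G.emit p).toMeasure G.historyKernel

/-- The law, on infinite sequences of symbols, of the output of `G` when the initial state has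
law `p`. -/
noncomputable def outputLaw (G : PFSA A Q) (p : PMF Q) : Measure (ℕ → A) :=
  (G.pathLaw p).map fun z n => (z n).2

/-- The process `X 0, X 1, …` on `(Ω, P)` is generated by `G` with initial state distribution
`p`. -/
def Generates {Ω : Type*} [MeasurableSpace Ω] (G : PFSA A Q) (p : PMF Q)
    (P : Measure Ω) (X : ℕ → Ω → A) : Prop :=
  HasLaw (fun ω n => X n ω) (G.outputLaw p) P

end Law

end PFSA

/-- Strict stationarity: the finite-dimensional distributions are invariant under time shifts. -/
def IsStationaryProcess {Ω A : Type*} [MeasurableSpace Ω] [MeasurableSpace A]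
    (P : Measure Ω) (X : ℕ → Ω → A) : Prop :=
  ∀ (k : ℕ) (t : Fin k → ℕ) (h : ℕ),
    P.map (fun ω (j : Fin k) => X (t j + h) ω) = P.map (fun ω (j : Fin k) => X (t j) ω)

open Classical in
/-- Ergodicity of a process over a finite alphabet: along almost every realization, every
finite-dimensional distribution is the limit of the empirical frequencies. -/
def IsErgodicProcess {Ω A : Type*} [MeasurableSpace Ω]
    (P : Measure Ω) (X : ℕ → Ω → A) : Prop :=
  ∀ (k : ℕ) (t : Fin k → ℕ) (w : Fin k → A), ∀ᵐ ω ∂P,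
    Tendsto (fun N : ℕ =>
        (((Finset.range N).filter fun s => ∀ j, X (t j + s) ω = w j).card : ℝ) / (N : ℝ))
      atTop (𝓝 (P.real {ω' | ∀ j, X (t j) ω' = w j}))

/-! Once the initial state is known, the symbols determine the state path, so the output law has a
renewal property (`outputLaw_pure_markov`): given that the first symbol from `q` is `a`, the shifted
output has the law started at `next q a`. Everything about the output rests on it.

The total-mass identity `∑ vΠ = ∑ v` makes `|v|` fixed whenever `v` is, which yields existence of a
stationary distribution; strong connectivity spreads positivity and yields uniqueness. Renewal
together with `pΠ = p` makes the shift measure preserving.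

For ergodicity, let `E` be shift-invariant. By renewal, `q ↦ P_q(E)` is harmonic, hence a constant
`c` by the maximum principle. Peeling off symbols gives `P_q(C ∩ E) = c P_q(C)` for every cylinder
`C`, so `E` is independent of itself and `c = c²`. Almost sure convergence of frequencies is then
Birkhoff's theorem, proved here for bounded functions through maxima of Birkhoff sums. -/

/-! ### Cylinders in sequence space -/

/-- The left shift on sequences. -/
def leftShift {α : Type*} (x : ℕ → α) (n : ℕ) : α := x (n + 1)

lemma measurable_leftShift {α : Type*} [MeasurableSpace α] :
    Measurable (leftShift : (ℕ → α) → ℕ → α) :=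
  measurable_pi_lambda _ fun n => measurable_pi_apply (n + 1)

lemma cylinder_succ_eq {α : Type*} (y : ℕ → α) (n : ℕ) :
    PiNat.cylinder (E := fun _ => α) y (n + 1) =
      {x | x 0 = y 0} ∩ leftShift ⁻¹' PiNat.cylinder (E := fun _ => α) (leftShift y) n := by
  ext x
  simp only [PiNat.cylinder, Set.mem_inter_iff, Set.mem_ofPred_eq, Set.mem_preimage, leftShift]
  constructor
  · intro h
    exact ⟨h 0 (by omega), fun i hi => h (i + 1) (by omega)⟩
  · rintro ⟨h0, h⟩ i hi
    cases i with
    | zero => exact h0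
    | succ i => exact h i (by omega)

lemma measurableSet_apply_eq {ι α : Type*} [MeasurableSpace α] [MeasurableSingletonClass α]
    (i : ι) (a : α) : MeasurableSet {x : ι → α | x i = a} :=
  (measurable_pi_apply (X := fun _ => α) i) (measurableSet_singleton a)

lemma measurableSet_cylinder {α : Type*} [MeasurableSpace α] [MeasurableSingletonClass α]
    (y : ℕ → α) (n : ℕ) : MeasurableSet (PiNat.cylinder (E := fun _ => α) y n) := by
  have : PiNat.cylinder (E := fun _ => α) y n = ⋂ i ∈ Set.Iio n, {x | x i = y i} := by
    ext x; simp [PiNat.cylinder]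
  rw [this]
  exact MeasurableSet.biInter (Set.to_countable _) fun i _ =>
    measurableSet_apply_eq i (y i)

lemma generateFrom_cylinder {α : Type*} [Countable α] [MeasurableSpace α]
    [MeasurableSingletonClass α] :
    (MeasurableSpace.pi : MeasurableSpace (ℕ → α)) =
      MeasurableSpace.generateFrom
        {s | ∃ (y : ℕ → α) (n : ℕ), s = PiNat.cylinder (E := fun _ => α) y n} := by
  apply le_antisymm
  · refine iSup_le fun i => ?_
    rw [MeasurableSpace.comap_le_iff_le_map]
    intro s _
    change MeasurableSet[MeasurableSpace.generateFrom _] ((fun x : ℕ → α => x i) ⁻¹' s)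
    -- A countable union over words of length `i + 1` ending in `s`. `Fin.ofNat` extends a word to a
    -- sequence; its values beyond `i` do not matter.
    have : (fun x : ℕ → α => x i) ⁻¹' s =
        ⋃ w : {w : Fin (i + 1) → α // w (Fin.last i) ∈ s},
          PiNat.cylinder (E := fun _ => α) (fun j => w.1 (Fin.ofNat (i + 1) j)) (i + 1) := by
      ext x
      simp only [Set.mem_preimage, Set.mem_iUnion, PiNat.cylinder, Set.mem_ofPred_eq]
      constructor
      · intro h
        refine ⟨⟨fun j => x j, by simpa using h⟩, fun j hj => ?_⟩
        simp [Fin.ofNat, Nat.mod_eq_of_lt hj]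
      · rintro ⟨w, hw⟩
        rw [hw i (by omega)]
        have : Fin.ofNat (i + 1) i = Fin.last i := by
          ext; simp [Fin.ofNat]
        rw [this]
        exact w.2
    rw [this]
    exact MeasurableSet.iUnion fun w => MeasurableSpace.measurableSet_generateFrom ⟨_, _, rfl⟩
  · refine MeasurableSpace.generateFrom_le ?_
    rintro _ ⟨y, n, rfl⟩
    exact measurableSet_cylinder y n

/-- Two cylinders with a common point `x` are both cylinders around `x`, hence nested. -/
lemma isPiSystem_cylinder {α : Type*} :
    IsPiSystem {s | ∃ (y : ℕ → α) (n : ℕ), s = PiNat.cylinder (E := fun _ => α) y n} := by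
  rintro _ ⟨y, n, rfl⟩ _ ⟨y', n', rfl⟩ ⟨x, hx, hx'⟩
  rw [← PiNat.mem_cylinder_iff_eq.1 hx, ← PiNat.mem_cylinder_iff_eq.1 hx']
  rcases le_total n n' with h | h
  · exact ⟨x, n', Set.inter_eq_right.2 (PiNat.cylinder_anti x h)⟩
  · exact ⟨x, n, Set.inter_eq_left.2 (PiNat.cylinder_anti x h)⟩

lemma MeasureTheory.Measure.ext_of_cylinder {α : Type*} [Countable α] [MeasurableSpace α]
    [MeasurableSingletonClass α] {μ ν : Measure (ℕ → α)} [IsFiniteMeasure μ]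
    (h : ∀ (y : ℕ → α) (n : ℕ), μ (PiNat.cylinder (E := fun _ => α) y n) =
      ν (PiNat.cylinder (E := fun _ => α) y n)) : μ = ν := by
  rcases isEmpty_or_nonempty (ℕ → α) with he | ⟨⟨y⟩⟩
  · exact Subsingleton.elim _ _
  refine ext_of_generate_finite _ generateFrom_cylinder isPiSystem_cylinder ?_ ?_
  · rintro _ ⟨y, n, rfl⟩
    exact h y n
  · simpa using h y 0

/-! ### Markov property of the path and output laws -/

namespace PFSA

lemma emit_apply {A Q : Type*} (G : PFSA A Q) (p : PMF Q) (q : Q) (a : A) :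
    G.emit p (q, a) = p q * G.obs q a := by
  classical
  rw [emit, PMF.bind_apply, tsum_eq_single q]
  · rw [PMF.map_apply, tsum_eq_single a]
    · simp
    · intro b hb; simp [hb.symm]
  · intro q' hq'
    rw [PMF.map_apply]
    simp [Prod.ext_iff, hq'.symm]

variable {A Q : Type*} [MeasurableSpace A] [MeasurableSpace Q]
  [Countable A] [Countable Q] [MeasurableSingletonClass A] [MeasurableSingletonClass Q]

lemma trajMeasure_initial (G : PFSA A Q) (ν : Measure (Q × A)) (z : Q × A) :
    Kernel.trajMeasure (X := fun _ => Q × A) ν G.historyKernel {x | x 0 = z} = ν {z} := by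
  have h : (Kernel.trajMeasure (X := fun _ => Q × A) ν G.historyKernel).map
      (Preorder.frestrictLe 0) = ν.map
        (MeasurableEquiv.piUnique (fun _ : Finset.Iic 0 => Q × A)).symm := by
    rw [Kernel.trajMeasure, Measure.map_comp _ _ (by fun_prop), Kernel.traj_map_frestrictLe,
      Kernel.partialTraj_self, Measure.id_comp]
  have h' := congrArg (fun m => m {w | w ⟨0, by simp⟩ = z}) h
  have hm : MeasurableSet {w : Finset.Iic 0 → Q × A | w ⟨0, by simp⟩ = z} :=
    measurableSet_apply_eq _ z
  beta_reduce at h'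
  rw [Measure.map_apply (by fun_prop) hm, Measure.map_apply (by fun_prop) hm] at h'
  exact h'

lemma trajMeasure_cylinder_succ (G : PFSA A Q) (ν : Measure (Q × A)) [IsProbabilityMeasure ν]
    (y : ℕ → Q × A) (n : ℕ) :
    Kernel.trajMeasure (X := fun _ => Q × A) ν G.historyKernel
        (PiNat.cylinder (E := fun _ => Q × A) y (n + 2)) =
      Kernel.trajMeasure (X := fun _ => Q × A) ν G.historyKernel
        (PiNat.cylinder (E := fun _ => Q × A) y (n + 1)) * G.stepKernel (y n) {y (n + 1)} := by
  have h := Kernel.map_frestrictLe_trajMeasure_compProd_eq_map_trajMeasure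
    (X := fun _ => Q × A) (μ₀ := ν) (κ := G.historyKernel) (a := n)
  have hm : MeasurableSet ({fun i : Finset.Iic n => y i} : Set (Finset.Iic n → Q × A)) :=
    measurableSet_singleton _
  have h' := congrArg (fun m => m (({fun i : Finset.Iic n => y i} : Set (Finset.Iic n → Q × A)) ×ˢ {y (n + 1)})) h
  beta_reduce at h'
  rw [Measure.compProd_apply_prod hm (measurableSet_singleton _),
    Measure.map_apply (by fun_prop) (hm.prod (measurableSet_singleton _)),
    lintegral_singleton, Measure.map_apply (by fun_prop) hm, mul_comm] at h'
  have e1 : (fun x : ℕ → Q × A => (Preorder.frestrictLe (π := fun _ => Q × A) n x, x (n + 1))) ⁻¹'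
      (({fun i : Finset.Iic n => y i} : Set (Finset.Iic n → Q × A)) ×ˢ {y (n + 1)}) =
      PiNat.cylinder (E := fun _ => Q × A) y (n + 2) := by
    ext x
    simp only [Set.mem_preimage, Set.mem_prod, Set.mem_singleton_iff, PiNat.cylinder,
      Set.mem_ofPred_eq, funext_iff, Subtype.forall, Finset.mem_Iic, Preorder.frestrictLe_apply]
    constructor
    · rintro ⟨h1, h2⟩ i hi
      rcases Nat.lt_or_ge i (n + 1) with h | h
      · exact h1 i (by omega)
      · obtain rfl : i = n + 1 := by omega
        exact h2
    · exact fun h => ⟨fun i hi => h i (by omega), h _ (by omega)⟩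
  have e2 : (Preorder.frestrictLe (π := fun _ => Q × A) n) ⁻¹'
      ({fun i : Finset.Iic n => y i} : Set (Finset.Iic n → Q × A)) =
      PiNat.cylinder (E := fun _ => Q × A) y (n + 1) := by
    ext x
    simp only [Set.mem_preimage, Set.mem_singleton_iff, PiNat.cylinder,
      Set.mem_ofPred_eq, funext_iff, Subtype.forall, Finset.mem_Iic, Preorder.frestrictLe_apply,
      Nat.lt_succ_iff]
  rw [e1, e2] at h'
  rw [← h']
  rfl

lemma trajMeasure_cylinder (G : PFSA A Q) (ν : Measure (Q × A)) [IsProbabilityMeasure ν]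
    (y : ℕ → Q × A) (n : ℕ) :
    Kernel.trajMeasure (X := fun _ => Q × A) ν G.historyKernel
        (PiNat.cylinder (E := fun _ => Q × A) y (n + 1)) =
      ν {y 0} * ∏ i ∈ Finset.range n, G.stepKernel (y i) {y (i + 1)} := by
  induction n with
  | zero =>
    rw [cylinder_succ_eq]
    simpa using G.trajMeasure_initial ν (y 0)
  | succ n ih => rw [trajMeasure_cylinder_succ, ih, Finset.prod_range_succ, mul_assoc]

/-- Both sides are finite measures in `F`, so the product formula on cylinders decides. The initial
law is arbitrary because the restarted chain begins with `stepKernel z`. -/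
lemma trajMeasure_markov (G : PFSA A Q) (ν : Measure (Q × A)) [IsProbabilityMeasure ν]
    (z : Q × A) {F : Set (ℕ → Q × A)} (hF : MeasurableSet F) :
    Kernel.trajMeasure (X := fun _ => Q × A) ν G.historyKernel
        ({x | x 0 = z} ∩ leftShift ⁻¹' F) =
      ν {z} * Kernel.trajMeasure (X := fun _ => Q × A) (G.stepKernel z) G.historyKernel F := by
  have hz : MeasurableSet {x : ℕ → Q × A | x 0 = z} :=
    measurableSet_apply_eq 0 z
  have key : ((Kernel.trajMeasure (X := fun _ => Q × A) ν G.historyKernel).restrict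
      {x | x 0 = z}).map leftShift =
      ν {z} • Kernel.trajMeasure (X := fun _ => Q × A) (G.stepKernel z) G.historyKernel := by
    refine Measure.ext_of_cylinder fun y n => ?_
    rw [Measure.map_apply measurable_leftShift (measurableSet_cylinder y n),
      Measure.restrict_apply (measurable_leftShift (measurableSet_cylinder y n)), Set.inter_comm,
      Measure.smul_apply, smul_eq_mul]
    -- The sequence is `y` with `z` prepended.
    have h := cylinder_succ_eq (fun i => Nat.casesOn i z y : ℕ → Q × A) n
    change _ = {x : ℕ → Q × A | x 0 = z} ∩ leftShift ⁻¹' PiNat.cylinder (E := fun _ => Q × A) y n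
      at h
    rw [← h, trajMeasure_cylinder]
    cases n with
    | zero => simp
    | succ n =>
      rw [trajMeasure_cylinder, Finset.prod_range_succ', mul_comm (Finset.prod _ _)]
      rfl
  have h := congrArg (fun m => m F) key
  beta_reduce at h
  rwa [Measure.map_apply measurable_leftShift hF,
    Measure.restrict_apply (measurable_leftShift hF), Set.inter_comm] at h

instance (G : PFSA A Q) (p : PMF Q) : IsProbabilityMeasure (G.pathLaw p) := by
  unfold pathLaw; infer_instance

lemma measurable_symbols {A Q : Type*} [MeasurableSpace A] [MeasurableSpace Q] :
    Measurable (fun (z : ℕ → Q × A) n => (z n).2) := by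
  fun_prop

instance (G : PFSA A Q) (p : PMF Q) : IsProbabilityMeasure (G.outputLaw p) :=
  Measure.isProbabilityMeasure_map measurable_symbols.aemeasurable

lemma pathLaw_eq_sum [Fintype Q] (G : PFSA A Q) (p : PMF Q) :
    G.pathLaw p = ∑ q, p q • G.pathLaw (PMF.pure q) := by
  classical
  refine Measure.ext_of_cylinder fun y n => ?_
  rw [Measure.finsetSum_apply]
  simp only [Measure.smul_apply, smul_eq_mul]
  cases n with
  | zero =>
    have := p.tsum_coe
    rw [tsum_fintype] at this
    simp [this]
  | succ n =>
    simp only [pathLaw, trajMeasure_cylinder, ← mul_assoc]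
    rw [← Finset.sum_mul]
    congr 1
    obtain ⟨q, a⟩ := y 0
    simp only [PMF.toMeasure_apply_singleton _ _ (measurableSet_singleton _), emit_apply,
      PMF.pure_apply]
    simp

lemma outputLaw_apply_eq_sum [Fintype Q] (G : PFSA A Q) (p : PMF Q) {F : Set (ℕ → A)}
    (hF : MeasurableSet F) :
    G.outputLaw p F = ∑ q, p q * G.outputLaw (PMF.pure q) F := by
  simp only [outputLaw, Measure.map_apply measurable_symbols hF]
  rw [pathLaw_eq_sum, Measure.finsetSum_apply]
  rfl

/-- After the first symbol has been output, the automaton starts afresh in the next state. -/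
lemma outputLaw_pure_markov [Fintype Q] (G : PFSA A Q) (q : Q) (a : A) {F : Set (ℕ → A)}
    (hF : MeasurableSet F) :
    G.outputLaw (PMF.pure q) ({x | x 0 = a} ∩ leftShift ⁻¹' F) =
      G.obs q a * G.outputLaw (PMF.pure (G.next q a)) F := by
  classical
  have hm : MeasurableSet ((fun (z : ℕ → Q × A) n => (z n).2) ⁻¹' F) := measurable_symbols hF
  -- Split by the hidden initial state; only `q' = q` carries mass.
  have hU : (fun (z : ℕ → Q × A) n => (z n).2) ⁻¹' ({x | x 0 = a} ∩ leftShift ⁻¹' F) =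
      ⋃ q' ∈ (Finset.univ : Finset Q), {x : ℕ → Q × A | x 0 = (q', a)} ∩
        leftShift ⁻¹' ((fun (z : ℕ → Q × A) n => (z n).2) ⁻¹' F) := by
    ext x
    simp only [Set.mem_inter_iff, Set.mem_preimage, Set.mem_ofPred_eq, Set.mem_iUnion,
      Finset.mem_univ, exists_true_left, exists_and_right, Prod.ext_iff, exists_eq', true_and]
    exact Iff.rfl
  simp only [outputLaw]
  rw [Measure.map_apply measurable_symbols
    ((measurableSet_apply_eq 0 a).inter (measurable_leftShift hF)), hU,
    measure_biUnion_finset _ fun q' _ =>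
      (measurableSet_apply_eq 0 _).inter (measurable_leftShift hm),
    Measure.map_apply measurable_symbols hF]
  · simp only [pathLaw]
    rw [Finset.sum_eq_single q]
    · rw [trajMeasure_markov G _ _ hm,
        PMF.toMeasure_apply_singleton _ _ (measurableSet_singleton _), emit_apply]
      simp only [PMF.pure_apply, if_true, one_mul]
      rfl
    · intro q' _ hq'
      rw [trajMeasure_markov G _ _ hm,
        PMF.toMeasure_apply_singleton _ _ (measurableSet_singleton _), emit_apply]
      simp [hq']
    · simp
  · intro q₁ _ q₂ _ hne
    refine Set.disjoint_left.2 fun x h₁ h₂ => hne ?_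
    exact congrArg Prod.fst (h₁.1.symm.trans h₂.1)

end PFSA

/-! ### Harmonic functions and stationary distributions -/

namespace PFSA

variable {A Q : Type*}

lemma obs_ne_zero_of_δ_eq_some (G : PFSA A Q) {q q' : Q} {a : A} (h : G.δ q a = some q') :
    G.obs q a ≠ 0 := by
  rw [Ne, ← G.δ_eq_none_iff, h]
  simp

variable [Fintype A]

lemma transitionMatrix_nonneg (G : PFSA A Q) (q q' : Q) : 0 ≤ G.transitionMatrix q q' := by
  classical
  rw [transitionMatrix, Matrix.of_apply]
  exact Finset.sum_nonneg fun _ _ => ENNReal.toReal_nonneg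

lemma transitionMatrix_pos (G : PFSA A Q) {q q' : Q} {a : A} (h : G.δ q a = some q') :
    0 < G.transitionMatrix q q' := by
  classical
  rw [transitionMatrix, Matrix.of_apply]
  refine Finset.sum_pos' (fun _ _ => ENNReal.toReal_nonneg) ⟨a, by simpa using h, ?_⟩
  exact ENNReal.toReal_pos (G.obs_ne_zero_of_δ_eq_some h) ((G.obs q).apply_ne_top a)

lemma sum_obs_toReal (G : PFSA A Q) (q : Q) : ∑ a, (G.obs q a).toReal = 1 := by
  have h := (G.obs q).tsum_coe
  rw [tsum_fintype] at h
  rw [← ENNReal.toReal_sum fun a _ => (G.obs q).apply_ne_top a, h, ENNReal.toReal_one]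

/-- Maximum principle: at a maximum the nonnegative deficits average to zero, so every edge, having
positive probability, leads to another maximum. -/
lemma eq_of_run_of_harmonic (G : PFSA A Q) {H : Q → ℝ}
    (hH : ∀ q, H q = ∑ a, (G.obs q a).toReal * H (G.next q a)) {q : Q} (hq : ∀ r, H r ≤ H q)
    (w : List A) {q' : Q} (hw : G.run q w = some q') : H q' = H q := by
  induction w generalizing q with
  | nil =>
    obtain rfl : q = q' := by simpa [run] using hw
    rfl
  | cons a w ih =>
    simp only [run, List.foldlM_cons, Option.bind_eq_bind, Option.bind_eq_some_iff] at hw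
    obtain ⟨r, hr, hw⟩ := hw
    have hsum : ∑ b, (G.obs q b).toReal * (H q - H (G.next q b)) = 0 := by
      simp only [mul_sub, Finset.sum_sub_distrib, ← hH q, ← Finset.sum_mul, sum_obs_toReal]
      ring
    have h := (Finset.sum_eq_zero_iff_of_nonneg fun b _ =>
      mul_nonneg ENNReal.toReal_nonneg (sub_nonneg.2 (hq _))).1 hsum a (Finset.mem_univ a)
    have hpos := ENNReal.toReal_pos (G.obs_ne_zero_of_δ_eq_some hr) ((G.obs q).apply_ne_top a)
    have hn : G.next q a = r := by simp [next, hr]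
    rw [hn] at h
    have hrq : H r = H q := by
      rcases mul_eq_zero.1 h with h | h <;> linarith
    rw [← hrq]
    exact ih (fun s => (hq s).trans_eq hrq.symm) hw

variable [Fintype Q]

lemma sum_transitionMatrix_mul (G : PFSA A Q) (f : Q → ℝ) (q : Q) :
    ∑ q', G.transitionMatrix q q' * f q' = ∑ a, (G.obs q a).toReal * f (G.next q a) := by
  classical
  simp only [transitionMatrix, Matrix.of_apply, Finset.sum_filter, Finset.sum_mul]
  rw [Finset.sum_comm]
  refine Finset.sum_congr rfl fun a _ => ?_
  cases h : G.δ q a with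
  -- The default value of `next` enters with weight zero.
  | none => simp [(G.δ_eq_none_iff q a).1 h]
  | some r => simp [next, h]

lemma sum_transitionMatrix (G : PFSA A Q) (q : Q) : ∑ q', G.transitionMatrix q q' = 1 := by
  simpa [sum_obs_toReal] using G.sum_transitionMatrix_mul (fun _ => 1) q

lemma sum_vecMul_transitionMatrix (G : PFSA A Q) (v : Q → ℝ) :
    ∑ q, Matrix.vecMul v G.transitionMatrix q = ∑ q, v q := by
  simp only [Matrix.vecMul, dotProduct]
  rw [Finset.sum_comm]
  simp [← Finset.mul_sum, sum_transitionMatrix]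

/-- The triangle inequality gives `|v| ≤ |v|Π` entrywise; equal total masses force equality. -/
lemma abs_vecMul_transitionMatrix (G : PFSA A Q) {v : Q → ℝ}
    (hv : Matrix.vecMul v G.transitionMatrix = v) :
    Matrix.vecMul (fun q => |v q|) G.transitionMatrix = fun q => |v q| := by
  have hle : ∀ q ∈ Finset.univ, |v q| ≤ Matrix.vecMul (fun q => |v q|) G.transitionMatrix q := by
    intro q _
    conv_lhs => rw [← hv]
    simp only [Matrix.vecMul, dotProduct]
    refine (Finset.abs_sum_le_sum_abs _ _).trans_eq (Finset.sum_congr rfl fun r _ => ?_)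
    rw [abs_mul, abs_of_nonneg (G.transitionMatrix_nonneg r q)]
  have h := (Finset.sum_eq_sum_iff_of_le hle).1 (G.sum_vecMul_transitionMatrix _).symm
  exact funext fun q => (h q (Finset.mem_univ q)).symm

lemma pos_of_run (G : PFSA A Q) {v : Q → ℝ} (h0 : ∀ q, 0 ≤ v q)
    (hv : Matrix.vecMul v G.transitionMatrix = v) (w : List A) {q q' : Q} (hq : 0 < v q)
    (hw : G.run q w = some q') : 0 < v q' := by
  induction w generalizing q with
  | nil =>
    obtain rfl : q = q' := by simpa [run] using hw
    exact hq
  | cons a w ih =>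
    simp only [run, List.foldlM_cons, Option.bind_eq_bind, Option.bind_eq_some_iff] at hw
    obtain ⟨r, hr, hw⟩ := hw
    refine ih ?_ hw
    rw [← hv]
    simp only [Matrix.vecMul, dotProduct]
    exact Finset.sum_pos' (fun s _ => mul_nonneg (h0 s) (G.transitionMatrix_nonneg s r))
      ⟨q, Finset.mem_univ q, mul_pos hq (G.transitionMatrix_pos hr)⟩

/-- If `v q > 0`, the nonnegative fixed vector `|v| + v` is positive at `q`, hence everywhere, so `v
> 0` everywhere. Applied to differences of stationary distributions, this gives uniqueness. -/
lemma nonpos_of_vecMul_eq_self (G : PFSA A Q) (hG : G.StronglyConnected) {v : Q → ℝ}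
    (hv : Matrix.vecMul v G.transitionMatrix = v) (hsum : ∑ q, v q ≤ 0) (q : Q) : v q ≤ 0 := by
  by_contra! hq
  let u : Q → ℝ := (fun q => |v q|) + v
  have hu : Matrix.vecMul u G.transitionMatrix = u := by
    rw [Matrix.add_vecMul, hv, abs_vecMul_transitionMatrix G hv]
  have hu0 : ∀ r, 0 ≤ u r := fun r => by
    have := neg_abs_le (v r)
    simp only [u, Pi.add_apply]
    linarith
  have hpos : ∀ r, 0 < v r := fun r => by
    obtain ⟨w, hw⟩ := hG q r
    have h1 := G.pos_of_run hu0 hu w (by simp only [u, Pi.add_apply]; positivity) hw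
    by_contra! h2
    simp [u, abs_of_nonpos h2] at h1
  exact absurd hsum (not_le.2 (Finset.sum_pos (fun r _ => hpos r) ⟨q, Finset.mem_univ q⟩))

lemma harmonic_eq_const [Nonempty Q] (G : PFSA A Q) (hG : G.StronglyConnected) {H : Q → ℝ}
    (hH : ∀ q, H q = ∑ a, (G.obs q a).toReal * H (G.next q a)) : ∃ c, ∀ q, H q = c := by
  obtain ⟨q, hq⟩ := Finite.exists_max H
  exact ⟨H q, fun q' => (hG q q').elim fun w hw => G.eq_of_run_of_harmonic hH hq w hw⟩

lemma exists_vecMul_eq_self [Nonempty Q] (G : PFSA A Q) :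
    ∃ v : Q → ℝ, v ≠ 0 ∧ Matrix.vecMul v G.transitionMatrix = v := by
  classical
  have h : (G.transitionMatrix - 1).det = 0 := by
    -- Row sums equal to 1 put the constant vector in the right kernel; the left kernel is then
    -- nonzero too.
    refine Matrix.exists_mulVec_eq_zero_iff.1 ⟨fun _ => 1, ?_, ?_⟩
    · exact fun h => one_ne_zero (congrFun h (Classical.arbitrary Q))
    · rw [Matrix.sub_mulVec, Matrix.one_mulVec, sub_eq_zero]
      funext q
      simp [Matrix.mulVec, dotProduct, sum_transitionMatrix]
  obtain ⟨v, hv0, hv⟩ := Matrix.exists_vecMul_eq_zero_iff.2 h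
  rw [Matrix.vecMul_sub, Matrix.vecMul_one, sub_eq_zero] at hv
  exact ⟨v, hv0, hv⟩

lemma exists_isStationaryDistribution [Nonempty Q] (G : PFSA A Q) :
    ∃ p : PMF Q, G.IsStationaryDistribution p := by
  obtain ⟨v, hv0, hv⟩ := G.exists_vecMul_eq_self
  obtain ⟨q₀, hq₀⟩ := Function.ne_iff.1 hv0
  have hs : 0 < ∑ q, |v q| :=
    Finset.sum_pos' (fun q _ => abs_nonneg _) ⟨q₀, Finset.mem_univ _, abs_pos.2 hq₀⟩
  let u : Q → ℝ := (∑ q, |v q|)⁻¹ • fun q => |v q|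
  have hu0 : ∀ q, 0 ≤ u q := fun q => by
    simp only [u, Pi.smul_apply, smul_eq_mul]
    positivity
  have hu1 : ∑ q, u q = 1 := by
    simp only [u, Pi.smul_apply, smul_eq_mul, ← Finset.mul_sum]
    exact inv_mul_cancel₀ hs.ne'
  have hu : Matrix.vecMul u G.transitionMatrix = u := by
    rw [Matrix.smul_vecMul, abs_vecMul_transitionMatrix G hv]
  refine ⟨PMF.ofFintype (fun q => ENNReal.ofReal (u q)) ?_, ?_⟩
  · rw [← ENNReal.ofReal_sum_of_nonneg fun q _ => hu0 q, hu1, ENNReal.ofReal_one]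
  · have : (fun q => ENNReal.toReal (ENNReal.ofReal (u q))) = u :=
      funext fun q => ENNReal.toReal_ofReal (hu0 q)
    simp only [IsStationaryDistribution, PMF.ofFintype_apply]
    rw [this, hu]

lemma sum_pmf_toReal (p : PMF Q) : ∑ q, (p q).toReal = 1 := by
  have h := p.tsum_coe
  rw [tsum_fintype] at h
  rw [← ENNReal.toReal_sum fun a _ => p.apply_ne_top a, h, ENNReal.toReal_one]

lemma IsStationaryDistribution.unique (G : PFSA A Q) (hG : G.StronglyConnected) {p p' : PMF Q}
    (hp : G.IsStationaryDistribution p) (hp' : G.IsStationaryDistribution p') : p = p' := by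
  have key : ∀ {r r' : PMF Q}, G.IsStationaryDistribution r → G.IsStationaryDistribution r' →
      ∀ q, (r q).toReal ≤ (r' q).toReal := by
    intro r r' hr hr' q
    rw [← sub_nonpos]
    refine G.nonpos_of_vecMul_eq_self hG (v := (fun q => (r q).toReal) - fun q => (r' q).toReal)
      ?_ ?_ q
    · rw [Matrix.sub_vecMul, hr, hr']
    · simp [sum_pmf_toReal]
  ext q
  exact (ENNReal.toReal_eq_toReal_iff' (p.apply_ne_top q) (p'.apply_ne_top q)).1
    (le_antisymm (key hp hp' q) (key hp' hp q))

end PFSA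

/-! ### Invariance and ergodicity of the output law -/

namespace PFSA

variable {A Q : Type*} [Fintype A] [Fintype Q] [MeasurableSpace A] [MeasurableSpace Q]
  [MeasurableSingletonClass A] [MeasurableSingletonClass Q]

lemma outputLaw_real_eq_sum (G : PFSA A Q) (p : PMF Q) {F : Set (ℕ → A)}
    (hF : MeasurableSet F) :
    (G.outputLaw p).real F = ∑ q, (p q).toReal * (G.outputLaw (PMF.pure q)).real F := by
  rw [measureReal_def, outputLaw_apply_eq_sum G p hF, ENNReal.toReal_sum]
  · simp [measureReal_def]
  · exact fun q _ => ENNReal.mul_ne_top (p.apply_ne_top q) (measure_ne_top _ _)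

lemma outputLaw_pure_real_preimage_leftShift (G : PFSA A Q) (q : Q) {F : Set (ℕ → A)}
    (hF : MeasurableSet F) :
    (G.outputLaw (PMF.pure q)).real (leftShift ⁻¹' F) =
      ∑ a, (G.obs q a).toReal * (G.outputLaw (PMF.pure (G.next q a))).real F := by
  have hU : leftShift ⁻¹' F = ⋃ a ∈ (Finset.univ : Finset A),
      ({x : ℕ → A | x 0 = a} ∩ leftShift ⁻¹' F) := by
    ext x
    simp
  rw [hU, measureReal_biUnion_finset]
  · simp [measureReal_def, outputLaw_pure_markov G q _ hF]
  · intro a₁ _ a₂ _ hne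
    exact Set.disjoint_left.2 fun x h₁ h₂ => hne (h₁.1.symm.trans h₂.1)
  · exact fun a _ => (measurableSet_apply_eq 0 a).inter (measurable_leftShift hF)

lemma measurePreserving_leftShift (G : PFSA A Q) {p : PMF Q} (hp : G.IsStationaryDistribution p) :
    MeasurePreserving leftShift (G.outputLaw p) (G.outputLaw p) := by
  refine ⟨measurable_leftShift, ?_⟩
  ext F hF
  rw [Measure.map_apply measurable_leftShift hF, ← measureReal_eq_measureReal_iff,
    outputLaw_real_eq_sum G p (measurable_leftShift hF), outputLaw_real_eq_sum G p hF]
  simp only [outputLaw_pure_real_preimage_leftShift G _ hF]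
  simp only [← G.sum_transitionMatrix_mul (fun q => (G.outputLaw (PMF.pure q)).real F),
    Finset.mul_sum]
  rw [Finset.sum_comm]
  refine Finset.sum_congr rfl fun q _ => ?_
  rw [← congrFun hp q]
  simp only [Matrix.vecMul, dotProduct, Finset.sum_mul, mul_assoc]

/-- Removing the first symbol leaves `E` unchanged but moves the initial state, so `hc` is needed
for all states at once. -/
lemma outputLaw_pure_cylinder_inter (G : PFSA A Q) {E : Set (ℕ → A)} (hE : MeasurableSet E)
    (hinv : leftShift ⁻¹' E = E) {c : ENNReal} (hc : ∀ q, G.outputLaw (PMF.pure q) E = c)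
    (q : Q) (y : ℕ → A) (n : ℕ) :
    G.outputLaw (PMF.pure q) (PiNat.cylinder (E := fun _ => A) y n ∩ E) =
      c * G.outputLaw (PMF.pure q) (PiNat.cylinder (E := fun _ => A) y n) := by
  induction n generalizing q y with
  | zero => simp [hc]
  | succ n ih =>
    have h : PiNat.cylinder (E := fun _ => A) y (n + 1) ∩ E = {x | x 0 = y 0} ∩
        leftShift ⁻¹' (PiNat.cylinder (E := fun _ => A) (leftShift y) n ∩ E) := by
      rw [Set.preimage_inter, hinv, ← Set.inter_assoc, ← cylinder_succ_eq]
    rw [h, cylinder_succ_eq, outputLaw_pure_markov G q _ ((measurableSet_cylinder _ n).inter hE),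
      outputLaw_pure_markov G q _ (measurableSet_cylinder _ n), ih]
    ring

lemma ergodic_leftShift [Nonempty Q] (G : PFSA A Q) (hG : G.StronglyConnected) {p : PMF Q}
    (hp : G.IsStationaryDistribution p) : Ergodic leftShift (G.outputLaw p) := by
  refine ⟨G.measurePreserving_leftShift hp, ⟨fun E hE hinv => ?_⟩⟩
  obtain ⟨c, hc⟩ := G.harmonic_eq_const hG (H := fun q => (G.outputLaw (PMF.pure q)).real E)
    fun q => by rw [← outputLaw_pure_real_preimage_leftShift G q hE, hinv]
  have hc' : ∀ q, G.outputLaw (PMF.pure q) E = ENNReal.ofReal c := fun q => by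
    rw [← hc q, ofReal_measureReal]
  have hmul : c = c * c := by
    let q := Classical.arbitrary Q
    -- Cylinders determine the measure, so the identity extends to all measurable sets; evaluating
    -- at `E` gives `c = c * c`.
    have hr : (G.outputLaw (PMF.pure q)).restrict E =
        ENNReal.ofReal c • G.outputLaw (PMF.pure q) := by
      refine Measure.ext_of_cylinder fun y n => ?_
      rw [Measure.restrict_apply (measurableSet_cylinder y n),
        outputLaw_pure_cylinder_inter G hE hinv hc']
      rfl
    have h := congrArg (fun m => m.real E) hr
    have h0 : 0 ≤ c := by rw [← hc q]; positivity
    simpa [hc, measureReal_restrict_apply hE, h0] using h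
  have hpc : (G.outputLaw p).real E = c := by
    rw [outputLaw_real_eq_sum G p hE]
    simp [hc, ← Finset.sum_mul, sum_pmf_toReal]
  rw [eventuallyConst_set']
  by_cases h : c = 0
  · left
    rw [ae_eq_empty]
    rw [h] at hpc
    exact (measureReal_eq_zero_iff).1 hpc
  · right
    rw [ae_eq_univ, prob_compl_eq_zero_iff hE]
    have h1 : c = 1 := by
      have := mul_left_cancel₀ h (hmul.symm.trans (mul_one c).symm)
      exact this
    rw [← ofReal_measureReal, hpc, h1, ENNReal.ofReal_one]

end PFSA

/-! ### Birkhoff's theorem for bounded functions -/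

section PointwiseErgodic

/-- The maximum of `0` and the first `n` Birkhoff sums of `g`. -/
noncomputable def birkhoffMax {α : Type*} (T : α → α) (g : α → ℝ) : ℕ → α → ℝ
  | 0, _ => 0
  | n + 1, x => max 0 (g x + birkhoffMax T g n (T x))

variable {α : Type*} {T : α → α} {g : α → ℝ}

lemma birkhoffMax_nonneg (n : ℕ) (x : α) : 0 ≤ birkhoffMax T g n x := by
  cases n with
  | zero => exact le_rfl
  | succ n => exact le_max_left _ _

lemma birkhoffMax_le_succ (n : ℕ) (x : α) : birkhoffMax T g n x ≤ birkhoffMax T g (n + 1) x := by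
  induction n generalizing x with
  | zero => exact birkhoffMax_nonneg 1 x
  | succ n ih => exact max_le_max le_rfl (by linarith [ih (T x)])

lemma monotone_birkhoffMax (x : α) : Monotone fun n => birkhoffMax T g n x :=
  monotone_nat_of_le_succ fun n => birkhoffMax_le_succ n x

lemma birkhoffSum_le_birkhoffMax (n : ℕ) (x : α) : birkhoffSum T g n x ≤ birkhoffMax T g n x := by
  induction n generalizing x with
  | zero => exact le_rfl
  | succ n ih =>
    rw [birkhoffSum_succ']
    exact le_max_of_le_right (by linarith [ih (T x)])

lemma birkhoffMax_le {C : ℝ} (hC : ∀ x, |g x| ≤ C) (n : ℕ) (x : α) :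
    birkhoffMax T g n x ≤ n * C := by
  have hC0 : 0 ≤ C := (abs_nonneg _).trans (hC x)
  induction n generalizing x with
  | zero => simp [birkhoffMax]
  | succ n ih =>
    refine max_le (by positivity) ?_
    push_cast
    linarith [ih (T x), le_of_abs_le (hC x)]

lemma bddAbove_birkhoffMax_comp_iff (x : α) :
    BddAbove (Set.range fun n => birkhoffMax T g n (T x)) ↔
      BddAbove (Set.range fun n => birkhoffMax T g n x) := by
  constructor
  · rintro ⟨K, hK⟩
    refine ⟨max 0 (g x + K), ?_⟩
    rintro _ ⟨n, rfl⟩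
    refine (birkhoffMax_le_succ n x).trans (max_le_max le_rfl ?_)
    linarith [hK ⟨n, rfl⟩]
  · rintro ⟨K, hK⟩
    refine ⟨K - g x, ?_⟩
    rintro _ ⟨n, rfl⟩
    have h1 : birkhoffMax T g (n + 1) x ≤ K := hK ⟨n + 1, rfl⟩
    have h2 : g x + birkhoffMax T g n (T x) ≤ birkhoffMax T g (n + 1) x := le_max_right _ _
    linarith

variable [MeasurableSpace α]

lemma measurable_birkhoffMax (hT : Measurable T) (hg : Measurable g) (n : ℕ) :
    Measurable (birkhoffMax T g n) := by
  induction n with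
  | zero => exact measurable_const
  | succ n ih => exact measurable_const.max (hg.add (ih.comp hT))

variable {μ : Measure α} [IsProbabilityMeasure μ]

lemma integrable_birkhoffMax (hT : Measurable T) (hg : Measurable g) {C : ℝ}
    (hC : ∀ x, |g x| ≤ C) (n : ℕ) : Integrable (birkhoffMax T g n) μ :=
  Integrable.of_bound (measurable_birkhoffMax hT hg n).aestronglyMeasurable (n * C)
    (Eventually.of_forall fun x => by
      rw [Real.norm_of_nonneg (birkhoffMax_nonneg n x)]
      exact birkhoffMax_le hC n x)

/-- If the partial maxima of the Birkhoff sums of `g` are almost surely unbounded, then `g` has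
non-negative mean. -/
lemma integral_nonneg_of_not_bddAbove (hT : MeasurePreserving T μ μ) (hg : Measurable g) {C : ℝ}
    (hC : ∀ x, |g x| ≤ C)
    (h : ∀ᵐ x ∂μ, ¬ BddAbove (Set.range fun n => birkhoffMax T g n x)) : 0 ≤ ∫ x, g x ∂μ := by
  have hint := integrable_birkhoffMax (μ := μ) hT.measurable hg hC
  -- Its integral is nonnegative, by invariance of `μ` and monotonicity in `n`. It equals `max
  -- (-birkhoffMax T g n (T x)) (g x)`, which is eventually `g x` when the maxima diverge; dominated
  -- convergence finishes.
  let D : ℕ → α → ℝ := fun n x => birkhoffMax T g (n + 1) x - birkhoffMax T g n (T x)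
  have hD : ∀ n x, D n x = max (-birkhoffMax T g n (T x)) (g x) := fun n x => by
    change max 0 (g x + birkhoffMax T g n (T x)) - birkhoffMax T g n (T x) = _
    rw [max_sub_sub_right _ _ _ |>.symm]
    simp
  have hD0 : ∀ n, 0 ≤ ∫ x, D n x ∂μ := fun n => by
    have hc : ∫ x, birkhoffMax T g n (T x) ∂μ = ∫ x, birkhoffMax T g n x ∂μ := by
      conv_rhs => rw [← hT.map_eq]
      rw [integral_map hT.aemeasurable
        (measurable_birkhoffMax hT.measurable hg n).aestronglyMeasurable]
    have hs : ∫ x, D n x ∂μ = _ :=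
      integral_sub (hint (n + 1)) (hT.integrable_comp_of_integrable (hint n))
    rw [hs]
    simp only [hc, sub_nonneg]
    exact integral_mono (hint n) (hint (n + 1)) (birkhoffMax_le_succ n)
  refine ge_of_tendsto' (tendsto_integral_of_dominated_convergence (fun _ => C) (F := D)
    (fun n => ?_) (integrable_const C) (fun n => Eventually.of_forall fun x => ?_) ?_) hD0
  · exact ((measurable_birkhoffMax hT.measurable hg (n + 1)).sub
      ((measurable_birkhoffMax hT.measurable hg n).comp hT.measurable)).aestronglyMeasurable
  · rw [hD, Real.norm_eq_abs, abs_le]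
    have h1 := abs_le.1 (hC x)
    have h2 : 0 ≤ birkhoffMax T g n (T x) := birkhoffMax_nonneg n (T x)
    exact ⟨h1.1.trans (le_max_right _ _), max_le (by linarith) h1.2⟩
  · filter_upwards [h] with x hx
    rw [← bddAbove_birkhoffMax_comp_iff] at hx
    have ht := tendsto_atTop_atTop_of_monotone' (monotone_birkhoffMax (T := T) (g := g) (T x)) hx
    refine tendsto_const_nhds.congr' ?_
    filter_upwards [ht.eventually_ge_atTop C] with n hn
    rw [hD, max_eq_right]
    linarith [(abs_le.1 (hC x)).1]

/-- Boundedness of the maxima is an invariant event, so it is null or full; a negative mean excludes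
null. -/
lemma Ergodic.ae_bddAbove_birkhoffSum (hT : Ergodic T μ) (hg : Measurable g) {C : ℝ}
    (hC : ∀ x, |g x| ≤ C) (hneg : ∫ x, g x ∂μ < 0) :
    ∀ᵐ x ∂μ, BddAbove (Set.range fun n => birkhoffSum T g n x) := by
  have hm : MeasurableSet {x | BddAbove (Set.range fun n => birkhoffMax T g n x)} :=
    measurableSet_bddAbove_range fun n => measurable_birkhoffMax hT.measurable hg n
  have hinv : T ⁻¹' {x | BddAbove (Set.range fun n => birkhoffMax T g n x)} =
      {x | BddAbove (Set.range fun n => birkhoffMax T g n x)} := by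
    ext x
    exact bddAbove_birkhoffMax_comp_iff x
  rcases hT.ae_mem_or_ae_notMem hm hinv with h | h
  · filter_upwards [h] with x ⟨K, hK⟩
    refine ⟨K, ?_⟩
    rintro _ ⟨n, rfl⟩
    exact (birkhoffSum_le_birkhoffMax n x).trans (hK ⟨n, rfl⟩)
  · exact absurd (integral_nonneg_of_not_bddAbove hT.toMeasurePreserving hg hC h) (not_le.2 hneg)

lemma Ergodic.ae_eventually_birkhoffAverage_lt (hT : Ergodic T μ) (hg : Measurable g) {C : ℝ}
    (hC : ∀ x, |g x| ≤ C) {b : ℝ} (hb : ∫ x, g x ∂μ < b) :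
    ∀ᵐ x ∂μ, ∀ᶠ n in atTop, birkhoffAverage ℝ T g n x < b := by
  -- A bound `K` on the sums of `g - c` bounds the averages of `g` by `K / n + c`, and `c < b`
  -- absorbs `K / n`.
  obtain ⟨c, hc, hcb⟩ := exists_between hb
  have hint : Integrable g μ :=
    Integrable.of_bound hg.aestronglyMeasurable C (Eventually.of_forall hC)
  have h := hT.ae_bddAbove_birkhoffSum (g := fun x => g x - c) (hg.sub_const c) (C := C + |c|)
    (fun x => (abs_sub _ _).trans (by linarith [hC x]))
    (by rw [integral_sub hint (integrable_const c)]; simpa using hc)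
  filter_upwards [h] with x ⟨K, hK⟩
  have ht : Tendsto (fun n : ℕ => K / n + c) atTop (𝓝 (0 + c)) :=
    (tendsto_const_div_atTop_nhds_zero_nat K).add_const c
  rw [zero_add] at ht
  filter_upwards [ht.eventually_lt_const hcb, eventually_gt_atTop 0] with n hn hn0
  refine lt_of_le_of_lt ?_ hn
  have h1 : birkhoffSum T (fun x => g x - c) n x ≤ K := hK ⟨n, rfl⟩
  have hn0' : (0 : ℝ) < n := by exact_mod_cast hn0
  simp only [birkhoffSum, Finset.sum_sub_distrib, Finset.sum_const, Finset.card_range,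
    nsmul_eq_mul] at h1
  rw [birkhoffAverage, smul_eq_mul, birkhoffSum, inv_mul_le_iff₀ hn0', mul_add,
    mul_div_cancel₀ _ hn0'.ne']
  linarith

/-- **Birkhoff's pointwise ergodic theorem** for a bounded function and an ergodic map. -/
theorem Ergodic.ae_tendsto_birkhoffAverage (hT : Ergodic T μ) (hg : Measurable g) {C : ℝ}
    (hC : ∀ x, |g x| ≤ C) :
    ∀ᵐ x ∂μ, Tendsto (fun n => birkhoffAverage ℝ T g n x) atTop (𝓝 (∫ x, g x ∂μ)) := by
  have hpos : ∀ n : ℕ, (0 : ℝ) < 1 / (n + 1) := fun n => Nat.one_div_pos_of_nat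
  have h1 : ∀ᵐ x ∂μ, ∀ k : ℕ, ∀ᶠ n in atTop,
      birkhoffAverage ℝ T g n x < ∫ x, g x ∂μ + 1 / ((k : ℝ) + 1) :=
    ae_all_iff.2 fun k => hT.ae_eventually_birkhoffAverage_lt hg hC (by linarith [hpos k])
  -- The upper bound for `-g` is the lower bound for `g`.
  have h2 : ∀ᵐ x ∂μ, ∀ k : ℕ, ∀ᶠ n in atTop,
      birkhoffAverage ℝ T (-g) n x < -∫ x, g x ∂μ + 1 / ((k : ℝ) + 1) :=
    ae_all_iff.2 fun k => hT.ae_eventually_birkhoffAverage_lt hg.neg (C := C)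
      (fun x => by simpa using hC x)
      (by simp only [Pi.neg_apply, integral_neg]; linarith [hpos k])
  filter_upwards [h1, h2] with x hx1 hx2
  rw [tendsto_order]
  constructor
  · intro a ha
    obtain ⟨k, hk⟩ := exists_nat_one_div_lt (sub_pos.2 ha)
    filter_upwards [hx2 k] with n hn
    rw [birkhoffAverage_neg, Pi.neg_apply, Pi.neg_apply] at hn
    linarith
  · intro a ha
    obtain ⟨k, hk⟩ := exists_nat_one_div_lt (sub_pos.2 ha)
    filter_upwards [hx1 k] with n hn
    linarith

end PointwiseErgodic

/-! ### Transfer from the law to the process -/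

lemma leftShift_iterate {α : Type*} (k : ℕ) (x : ℕ → α) (n : ℕ) :
    leftShift^[k] x n = x (n + k) := by
  induction k generalizing x with
  | zero => rfl
  | succ k ih =>
    rw [Function.iterate_succ_apply, ih, leftShift]
    congr 1

section Ergodicity

variable {Ω A : Type*} [MeasurableSpace Ω] [MeasurableSpace A] {P : Measure Ω} {X : ℕ → Ω → A}
  {μ : Measure (ℕ → A)}

lemma ProbabilityTheory.HasLaw.isStationaryProcess (hX : HasLaw (fun ω n => X n ω) μ P)
    (hμ : MeasurePreserving leftShift μ μ) : IsStationaryProcess P X := by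
  intro k t h
  have hm : ∀ t : Fin k → ℕ, Measurable fun (x : ℕ → A) j => x (t j) := fun t =>
    measurable_pi_lambda _ fun j => measurable_pi_apply (t j)
  have hmap : ∀ t : Fin k → ℕ,
      P.map (fun ω j => X (t j) ω) = μ.map fun (x : ℕ → A) j => x (t j) := fun t => by
    rw [← hX.map_eq, AEMeasurable.map_map_of_aemeasurable (hm t).aemeasurable hX.aemeasurable]
    rfl
  rw [hmap t, hmap fun j => t j + h]
  conv_rhs => rw [← (hμ.iterate h).map_eq, Measure.map_map (hm t) (hμ.iterate h).measurable]
  congr 1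
  ext x j
  exact (leftShift_iterate h x (t j)).symm

lemma ProbabilityTheory.HasLaw.isErgodicProcess [MeasurableSingletonClass A]
    [IsProbabilityMeasure μ] (hX : HasLaw (fun ω n => X n ω) μ P)
    (hμ : Ergodic leftShift μ) : IsErgodicProcess P X := by
  classical
  intro k t w
  let C : Set (ℕ → A) := {x | ∀ j, x (t j) = w j}
  have hC : MeasurableSet C := by
    have : C = ⋂ j, {x | x (t j) = w j} := by ext x; simp [C]
    rw [this]
    exact MeasurableSet.iInter fun j => measurableSet_apply_eq (t j) (w j)
  -- Birkhoff averages of this indicator are the empirical frequencies.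
  have h := hμ.ae_tendsto_birkhoffAverage (g := C.indicator fun _ => (1 : ℝ))
    (measurable_const.indicator hC) (C := 1) fun x => by
      by_cases hx : x ∈ C <;> simp [hx]
  rw [← hX.map_eq] at h
  filter_upwards [ae_of_ae_map hX.aemeasurable h] with ω hω
  rw [hX.map_eq, integral_indicator_const _ hC, smul_eq_mul, mul_one,
    ← hX.measureReal_eq hC] at hω
  refine hω.congr fun N => ?_
  rw [birkhoffAverage, birkhoffSum, smul_eq_mul, inv_mul_eq_div, Finset.card_filter,
    Nat.cast_sum]
  congr 1
  refine Finset.sum_congr rfl fun s _ => ?_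
  simp [Set.indicator_apply, C, leftShift_iterate]

end Ergodicity

theorem mainTheorem7 {A Q : Type*} [Fintype A] [Fintype Q] [Nonempty Q]
    [MeasurableSpace A] [MeasurableSingletonClass A]
    [MeasurableSpace Q] [MeasurableSingletonClass Q]
    (G : PFSA A Q) (hG : G.StronglyConnected) :
    (∃! p : PMF Q, G.IsStationaryDistribution p) ∧
    ∀ p : PMF Q, G.IsStationaryDistribution p →
      ∀ {Ω : Type*} [MeasurableSpace Ω] (P : Measure Ω) (X : ℕ → Ω → A),
        G.Generates p P X →
          IsStationaryProcess P X ∧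
          IsErgodicProcess P X ∧
          Ergodic (fun (x : ℕ → A) (n : ℕ) => x (n + 1)) (P.map fun ω n => X n ω) := by
  refine ⟨?_, fun p hp Ω _ P X hX => ?_⟩
  · obtain ⟨p, hp⟩ := G.exists_isStationaryDistribution
    exact ⟨p, hp, fun p' hp' => PFSA.IsStationaryDistribution.unique G hG hp' hp⟩
  · have hE := G.ergodic_leftShift hG hp
    have hL : HasLaw (fun ω n => X n ω) (G.outputLaw p) P := hX
    refine ⟨hL.isStationaryProcess hE.toMeasurePreserving, hL.isErgodicProcess hE, ?_⟩
    rw [hL.map_eq]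
    exact hE
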